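/- Let $\ast$ be a continuous $t$-norm on $[0,1]$ with $a-a\ast b\ge a\ast(1-b)$ for all $a,b\in[0,1]$ (property (TN1)). A non-Archimedean fuzzy metric on a set $X$ (with respect to $\ast$) is a map $M:X\times X\times[0,\infty)\to[0,1]$ such that $M(x,y,0)=0$; $M(x,y,t)=1$ for all $t>0$ iff $x=y$; $M(x,y,t)=M(y,x,t)$; $M(x,z,\max\{t,s\})\ge M(x,y,t)\ast M(y,z,s)$ for $t,s>0$; and $M(x,y,\cdot)$ is left continuous. Its topology $\tau_M$ has the balls $B(x,\varepsilon,t)=\{y: M(x,y,t)>1-\varepsilon\}$, $0<\varepsilon<1$, $t>0$, as neighbourhood bases. Put $\mathrm{diam}_t(X)=\inf_{x,y}M(x,y,t)$; let $\mathrm{Cov}(X,\varepsilon,t)$ be the least number of balls $B(c,\varepsilon,t)$ that cover $X$; a $(t,\varepsilon)$-net is a set $A$ such that every $x\in X$ has some $y\in A$ with $M(x,y,t)>1-\varepsilon$. For two such spaces $X,Y$ let $$M_{GH}(X,Y,t)=\sup_M\ \min\Big\{\inf_{x\in X}\sup_{y\in Y}M(x,y,t),\ \inf_{y\in Y}\sup_{x\in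 X}M(x,y,t)\Big\},$$ the supremum being over all non-Archimedean fuzzy metrics $M$ on $X\sqcup Y$ that extend those of $X$ and $Y$. It is a function of isometry classes (an isometry is a bijection that preserves the fuzzy metrics), and it induces, by the same balls, a topology on the space of isometry classes of all nonempty compact non-Archimedean fuzzy metric spaces with respect to $\ast$. Let $\mathcal M$ be a family of nonempty compact non-Archimedean fuzzy metric spaces with respect to $\ast$, and let $\mathcal I(\mathcal M)$ be the set of isometry classes of its members. Assume: (1) there is a nondecreasing left-continuous function $C:(0,\infty)\to(0,1]$ with $C(s)\le\mathrm{diam}_s(X)$ for all $s>0$ and all $X\in\mathcal M$; (2) for all $t>0$ and $0<\varepsilon<1$ there is a natural number $N(\varepsilon,t)$ with $\mathrm{Cov}(X,\varepsilon,t)\le N(\varepsilon,t)$ for all $X\in\mathcal M$; (3) for every sequence $(X_n,M_n)_{n\in\mathbb N}$ in $\mathcal M$, all $t>0$ and all $0<\varepsilon<1$ there are, with $N=N(\varepsilon,t)$, $(t,\varepsilon)$-nets $\{x_i^n\}_{i=1}^{N}$ in $X_n$ ($n\in\mathbb N$) such that for all $n,m$, all $s>t$ and all $i,j\in\{1,\dots,N\}$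 with $M_n(x_i^n,x_j^n,s)<M_m(x_i^m,x_j^m,s)$ one has $$\frac{M_n(x_i^n,x_j^n,s)}{M_m(x_i^m,x_j^m,s)\ast(1-\varepsilon)}\ \ge\ \frac{M_n(x_i^n,x_j^n,t)}{M_m(x_i^m,x_j^m,t)\ast(1-\varepsilon)}$$ whenever the denominators are not zero. Then $\mathcal I(\mathcal M)$ is relatively compact: its closure, with respect to $M_{GH}$, in the space of isometry classes of all nonempty compact non-Archimedean fuzzy metric spaces with respect to $\ast$ is compact. In particular, $(\mathcal I(\mathcal M),M_{GH},\ast)$ is a compact space whenever it is complete, that is, whenever every $M_{GH}$-Cauchy sequence in $\mathcal I(\mathcal M)$ converges to an element of $\mathcal I(\mathcal M)$. -/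

import Mathlib

open Set Filter Topology unitInterval
open scoped NNReal

universe u

noncomputable section

/-- A continuous t-norm on `[0,1]`. -/
structure ContTNorm where
  op : I → I → I
  assoc : ∀ a b c, op (op a b) c = op a (op b c)
  comm : ∀ a b, op a b = op b a
  continuous_op : Continuous fun p : I × I => op p.1 p.2
  op_one : ∀ a, op a 1 = a
  mono : ∀ a b c d, a ≤ c → b ≤ d → op a b ≤ op c d

/-- Property (TN1): `a - a ∗ b ≥ a ∗ (1 - b)` for all `a, b ∈ [0,1]`. -/
def ContTNorm.TN1 (T : ContTNorm) : Prop :=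
  ∀ a b : I, (T.op a (σ b) : ℝ) ≤ (a : ℝ) - (T.op a b : ℝ)

/-- A non-Archimedean fuzzy metric (in the sense of Kramosil and Michalek) on `X`
with respect to the continuous t-norm `T`. -/
structure NAFuzzyMetric (T : ContTNorm) (X : Type*) where
  M : X → X → ℝ≥0 → I
  at_zero : ∀ x y, M x y 0 = 0
  eq_one_iff : ∀ x y, (∀ t, 0 < t → M x y t = 1) ↔ x = y
  symm : ∀ x y t, 0 < t → M x y t = M y x t
  nonarch : ∀ x y z t s, 0 < t → 0 < s → T.op (M x y t) (M y z s) ≤ M x z (max t s)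
  left_cont : ∀ x y t, ContinuousWithinAt (M x y) (Iic t) t

namespace FuzzySet

variable {α : Type*}

/-- The open ball `B(x, ε, t) = {y | F(x,y,t) > 1 - ε}`. -/
def ball (F : α → α → ℝ≥0 → I) (x : α) (ε : I) (t : ℝ≥0) : Set α :=
  {y | σ ε < F x y t}

/-- The topology in which a set is open when it contains, around each of its points `x`,
a ball `B(x, ε, t)` with `0 < ε < 1` and `t > 0`. -/
@[reducible] def topology (F : α → α → ℝ≥0 → I) (hF : ∀ x y, Monotone (F x y)) : TopologicalSpace α where
  IsOpen U := ∀ x ∈ U, ∃ (ε : I) (t : ℝ≥0), 0 < ε ∧ ε < 1 ∧ 0 < t ∧ ball F x ε t ⊆ U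
  isOpen_univ := by
    intro x _
    refine ⟨⟨1 / 2, by norm_num, by norm_num⟩, 1, ?_, ?_, one_pos, subset_univ _⟩
    · exact Subtype.mk_lt_mk.2 (by norm_num)
    · exact Subtype.mk_lt_mk.2 (by norm_num)
  isOpen_inter := by
    intro U V hU hV x hx
    obtain ⟨ε₁, t₁, h₁, h₁', ht₁, hs₁⟩ := hU x hx.1
    obtain ⟨ε₂, t₂, h₂, h₂', ht₂, hs₂⟩ := hV x hx.2
    refine ⟨min ε₁ ε₂, min t₁ t₂, lt_min h₁ h₂, lt_of_le_of_lt (min_le_left _ _) h₁',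
      lt_min ht₁ ht₂, fun y hy => ⟨hs₁ ?_, hs₂ ?_⟩⟩
    · exact lt_of_le_of_lt (unitInterval.symm_le_symm.2 (min_le_left _ _))
        (lt_of_lt_of_le hy (hF x y (min_le_left _ _)))
    · exact lt_of_le_of_lt (unitInterval.symm_le_symm.2 (min_le_right _ _))
        (lt_of_lt_of_le hy (hF x y (min_le_right _ _)))
  isOpen_sUnion := by
    intro S hS x ⟨U, hU, hx⟩
    obtain ⟨ε, t, h, h', ht, hs⟩ := hS U hU x hx
    exact ⟨ε, t, h, h', ht, hs.trans (subset_sUnion_of_mem hU)⟩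

/-- `A` is a `(t, ε)`-net. -/
def IsNet (F : α → α → ℝ≥0 → I) (t : ℝ≥0) (ε : I) (A : Set α) : Prop :=
  ∀ x, ∃ y ∈ A, σ ε < F x y t

/-- The cover number `Cov(X, ε, t)`: the least cardinality of a set of centres of balls
`B(c, ε, t)` covering the space (`⊤` if no finite set will do). -/
def cov (F : α → α → ℝ≥0 → I) (ε : I) (t : ℝ≥0) : ℕ∞ :=
  sInf {k | ∃ C : Set α, (⋃ c ∈ C, ball F c ε t) = univ ∧ k = C.encard}

/-- The `t`-diameter. -/
def diam (F : α → α → ℝ≥0 → I) (t : ℝ≥0) : I := ⨅ (x : α) (y : α), F x y t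

/-- The Hausdorff fuzzy set
`H(A,B,t) = min {inf_{a ∈ A} sup_{b ∈ B} F(a,b,t), inf_{b ∈ B} sup_{a ∈ A} F(a,b,t)}`. -/
def hausdorff (F : α → α → ℝ≥0 → I) (A B : Set α) (t : ℝ≥0) : I :=
  min (⨅ a ∈ A, ⨆ b ∈ B, F a b t) (⨅ b ∈ B, ⨆ a ∈ A, F a b t)

/-- Cauchy sequences. -/
def IsCauchySeq (F : α → α → ℝ≥0 → I) (u : ℕ → α) : Prop :=
  ∀ (t : ℝ≥0) (ε : I), 0 < t → 0 < ε → ε < 1 →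
    ∃ n₀ : ℕ, ∀ n m, n₀ ≤ n → n₀ ≤ m → σ ε < F (u n) (u m) t

/-- Convergence of a sequence: `F(uₙ, a, t) → 1` for all `t > 0`. -/
def ConvergesTo (F : α → α → ℝ≥0 → I) (u : ℕ → α) (a : α) : Prop :=
  ∀ t : ℝ≥0, 0 < t → Tendsto (fun n => F (u n) a t) atTop (𝓝 1)

/-- Every Cauchy sequence in `S` converges to a point of `S`. -/
def CompleteOn (F : α → α → ℝ≥0 → I) (S : Set α) : Prop :=
  ∀ u : ℕ → α, (∀ n, u n ∈ S) → IsCauchySeq F u → ∃ a ∈ S, ConvergesTo F u a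

end FuzzySet

namespace NAFuzzyMetric

variable {T : ContTNorm} {X Y : Type*}

theorem M_mono (m : NAFuzzyMetric T X) (x y : X) : Monotone (m.M x y) := by
  intro s t hst
  rcases eq_or_lt_of_le (zero_le : 0 ≤ s) with h0 | h0
  · rw [← h0, m.at_zero]; exact bot_le
  · have h1 : m.M y y t = 1 := (m.eq_one_iff y y).2 rfl t (h0.trans_le hst)
    have h := m.nonarch x y y s t h0 (h0.trans_le hst)
    rwa [h1, T.op_one, max_eq_right hst] at h

/-- The topology `τ_M` of a non-Archimedean fuzzy metric. -/
@[reducible] def topology (m : NAFuzzyMetric T X) : TopologicalSpace X :=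
  FuzzySet.topology m.M m.M_mono

/-- A non-Archimedean fuzzy metric on the disjoint union is admissible if it restricts to the
given ones. -/
def IsAdmissible (mX : NAFuzzyMetric T X) (mY : NAFuzzyMetric T Y)
    (m : NAFuzzyMetric T (X ⊕ Y)) : Prop :=
  (∀ x x' t, m.M (Sum.inl x) (Sum.inl x') t = mX.M x x' t) ∧
    ∀ y y' t, m.M (Sum.inr y) (Sum.inr y') t = mY.M y y' t

/-- The non-Archimedean Gromov-Hausdorff fuzzy distance: the supremum of `H_m(X, Y, t)` over all
admissible non-Archimedean fuzzy metrics `m` on `X ⊔ Y`. -/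
def gh (mX : NAFuzzyMetric T X) (mY : NAFuzzyMetric T Y) (t : ℝ≥0) : I :=
  ⨆ (m : NAFuzzyMetric T (X ⊕ Y)) (_ : IsAdmissible mX mY m),
    FuzzySet.hausdorff m.M (range Sum.inl) (range Sum.inr) t

theorem gh_mono (mX : NAFuzzyMetric T X) (mY : NAFuzzyMetric T Y) : Monotone (gh mX mY) := by
  intro s t hst
  refine iSup₂_mono fun m _ => min_le_min ?_ ?_
  · exact iInf₂_mono fun a _ => iSup₂_mono fun b _ => m.M_mono _ _ hst
  · exact iInf₂_mono fun b _ => iSup₂_mono fun a _ => m.M_mono _ _ hst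

/-- Isometric spaces: there is a bijection preserving the fuzzy metrics. -/
def Isometric (mX : NAFuzzyMetric T X) (mY : NAFuzzyMetric T Y) : Prop :=
  ∃ e : X ≃ Y, ∀ x x' t, mY.M (e x) (e x') t = mX.M x x' t

/-- Transport of a fuzzy metric along a bijection. -/
def pullback (e : X ≃ Y) (m : NAFuzzyMetric T Y) : NAFuzzyMetric T X where
  M x x' t := m.M (e x) (e x') t
  at_zero _ _ := m.at_zero _ _
  eq_one_iff _ _ := (m.eq_one_iff _ _).trans e.injective.eq_iff
  symm _ _ := m.symm _ _
  nonarch _ _ _ := m.nonarch _ _ _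
  left_cont _ _ := m.left_cont _ _

theorem gh_le_of_isometric {X' Y' : Type*} {mX : NAFuzzyMetric T X} {mY : NAFuzzyMetric T Y}
    {mX' : NAFuzzyMetric T X'} {mY' : NAFuzzyMetric T Y'}
    (hX : Isometric mX mX') (hY : Isometric mY mY') (t : ℝ≥0) :
    gh mX' mY' t ≤ gh mX mY t := by
  obtain ⟨e, he⟩ := hX
  obtain ⟨f, hf⟩ := hY
  refine iSup₂_le fun m hm => ?_
  refine le_trans ?_ (le_iSup₂ (f := fun (m : NAFuzzyMetric T (X ⊕ Y))
    (_ : IsAdmissible mX mY m) => FuzzySet.hausdorff m.M (range Sum.inl) (range Sum.inr) t)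
    (pullback (Equiv.sumCongr e f) m)
    ⟨fun x x' t => (hm.1 _ _ _).trans (he x x' t), fun y y' t => (hm.2 _ _ _).trans (hf y y' t)⟩)
  apply le_of_eq
  simp only [FuzzySet.hausdorff, iInf_range, iSup_range, pullback, Equiv.sumCongr_apply,
    Sum.map_inl, Sum.map_inr]
  congr 1
  · rw [← e.iInf_comp]
    exact iInf_congr fun x => (f.iSup_comp (g := fun y => m.M (Sum.inl (e x)) (Sum.inr y) t)).symm
  · rw [← f.iInf_comp]
    exact iInf_congr fun y => (e.iSup_comp (g := fun x => m.M (Sum.inl x) (Sum.inr (f y)) t)).symm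

theorem Isometric.symm {mX : NAFuzzyMetric T X} {mY : NAFuzzyMetric T Y}
    (h : Isometric mX mY) : Isometric mY mX := by
  obtain ⟨e, he⟩ := h
  exact ⟨e.symm, fun y y' t => by rw [← he, e.apply_symm_apply, e.apply_symm_apply]⟩

end NAFuzzyMetric

/-- A nonempty compact non-Archimedean fuzzy metric space with t-norm `T`. -/
structure CompactNAFuzzySpace (T : ContTNorm) : Type (u + 1) where
  carrier : Type u
  nonempty : Nonempty carrier
  met : NAFuzzyMetric T carrier
  compact : @CompactSpace carrier met.topology

/-- The isometry relation. -/
instance CompactNAFuzzySpace.setoid (T : ContTNorm) : Setoid (CompactNAFuzzySpace.{u} T) where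
  r X Y := NAFuzzyMetric.Isometric X.met Y.met
  iseqv :=
    { refl := fun _ => ⟨Equiv.refl _, fun _ _ _ => rfl⟩
      symm := fun h => h.symm
      trans := fun ⟨e, he⟩ ⟨f, hf⟩ =>
        ⟨e.trans f, fun x x' t => (hf _ _ t).trans (he x x' t)⟩ }

/-- The space of isometry classes of all nonempty compact non-Archimedean fuzzy metric spaces. -/
def FuzzyGHSpace (T : ContTNorm) : Type (u + 1) :=
  Quotient (CompactNAFuzzySpace.setoid.{u} T)

namespace FuzzyGHSpace

variable {T : ContTNorm}

/-- The isometry class of a space. -/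
def mk (X : CompactNAFuzzySpace.{u} T) : FuzzyGHSpace.{u} T :=
  Quotient.mk (CompactNAFuzzySpace.setoid T) X

/-- The Gromov-Hausdorff fuzzy metric `M_GH` on isometry classes. -/
def ghM : FuzzyGHSpace.{u} T → FuzzyGHSpace.{u} T → ℝ≥0 → I :=
  Quotient.lift₂ (fun X Y => NAFuzzyMetric.gh X.met Y.met) (by
    intro X Y X' Y' h h'
    funext t
    exact le_antisymm (NAFuzzyMetric.gh_le_of_isometric h.symm h'.symm t)
      (NAFuzzyMetric.gh_le_of_isometric h h' t))

theorem ghM_mono (p q : FuzzyGHSpace.{u} T) : Monotone (ghM p q) := by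
  induction p using Quotient.ind
  induction q using Quotient.ind
  exact NAFuzzyMetric.gh_mono _ _

/-- The topology induced by `M_GH`. -/
instance : TopologicalSpace (FuzzyGHSpace.{u} T) := FuzzySet.topology ghM ghM_mono

/-- `I(𝓜)`: the set of isometry classes of members of `𝓜`. -/
def classes (𝓜 : Set (CompactNAFuzzySpace.{u} T)) : Set (FuzzyGHSpace.{u} T) := mk '' 𝓜

end FuzzyGHSpace

/-- The quotient condition on a sequence of spaces `Xₙ`: for all `t > 0` and `0 < ε < 1` there are
`(t, ε)`-nets `{xᵢⁿ : i = 1, …, N(ε,t)}` in `Xₙ` such that for all `n, m`, all `s > t` and all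
`i, j`, if `Mₙ(xᵢⁿ,xⱼⁿ,s) < Mₘ(xᵢᵐ,xⱼᵐ,s)` then
`Mₙ(xᵢⁿ,xⱼⁿ,s) / (Mₘ(xᵢᵐ,xⱼᵐ,s) ∗ (1-ε)) ≥ Mₙ(xᵢⁿ,xⱼⁿ,t) / (Mₘ(xᵢᵐ,xⱼᵐ,t) ∗ (1-ε))`.
The inequality is required only where both quotients are defined; as the first denominator is at
least the second one, this means that the second one is not zero. -/
def QuotientCondition {T : ContTNorm} (N : I → ℝ≥0 → ℕ)
    (X : ℕ → CompactNAFuzzySpace.{u} T) : Prop :=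
  ∀ (t : ℝ≥0) (ε : I), 0 < t → 0 < ε → ε < 1 →
    ∃ x : (n : ℕ) → Fin (N ε t) → (X n).carrier,
      (∀ n, FuzzySet.IsNet (X n).met.M t ε (range (x n))) ∧
      ∀ (n m : ℕ) (s : ℝ≥0) (i j : Fin (N ε t)), t < s →
        (X n).met.M (x n i) (x n j) s < (X m).met.M (x m i) (x m j) s →
        T.op ((X m).met.M (x m i) (x m j) t) (σ ε) ≠ 0 →
        ((X n).met.M (x n i) (x n j) t : ℝ) / (T.op ((X m).met.M (x m i) (x m j) t) (σ ε) : ℝ) ≤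
          ((X n).met.M (x n i) (x n j) s : ℝ) / (T.op ((X m).met.M (x m i) (x m j) s) (σ ε) : ℝ)

end

noncomputable section

/-! The balls of $M_{GH}$ come from a countably generated uniformity, because $M_{GH}$ is a fuzzy
pseudometric (`FuzzyGHSpace.isPseudo_ghM`); the triangle inequality is obtained by composing cross
distances (`IsBridge.comp`). Hence compactness follows from sequential compactness, and it is enough
that every sequence $X_n$ in $\mathcal M$ has a subsequence converging to some compact space.

The limit is the ultraproduct of the $X_n$ along a nonprincipal ultrafilter: the pointwise
ultralimit of the $M_n$, made left continuous and then separated. It is complete by a diagonal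
argument (`exists_ulim_diagonal`) and totally bounded because nets of uniform finite size pass to
the ultralimit (`exists_ulim_net`), so it is compact.

For convergence, take the nets of the quotient condition at a level $t_0$. Their mutual distances at
$t_0$ have ultralimits $L \ge C(t_0) > 0$. Property (TN1) leaves no idempotents besides 0 and 1,
hence $L \ast (1-\varepsilon) < L$ (`TN1.op_lt_left`), and any $c$ strictly in between shows that
for ultrafilter-many $n, n'$ the distances at $t_0$ agree up to the factor $1-\varepsilon$. The
quotient condition carries this to all levels $s > t_0$ (`op_le_of_quotient_le`), and nets with
nearly equal distances above $t_0$ can be glued (`le_gh_of_nets`). So $X_n$ tends to the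
ultraproduct along the ultrafilter, and a subsequence converges. -/

theorem unitInterval.exists_pos_of_eventually {p : I → Prop} (h : ∀ᶠ ε in 𝓝 (0 : I), p ε) :
    ∃ ε, 0 < ε ∧ ε < 1 ∧ p ε := by
  have : (𝓝[>] (0 : I)).NeBot := nhdsGT_neBot_of_exists_gt ⟨1, zero_lt_one⟩
  have h1 : ∀ᶠ ε in 𝓝 (0 : I), ε < 1 := Iio_mem_nhds zero_lt_one
  obtain ⟨ε, h0, h1, hp⟩ := ((eventually_mem_nhdsWithin (a := (0 : I)) (s := Ioi 0)).and
    ((h1.and h).filter_mono nhdsWithin_le_nhds)).exists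
  exact ⟨ε, h0, h1, hp⟩

/-! ### Continuous t-norms and the effect of (TN1). -/

namespace ContTNorm

variable (T : ContTNorm)

instance : Std.Associative T.op := ⟨T.assoc⟩

instance : Std.Commutative T.op := ⟨T.comm⟩

theorem one_op (a : I) : T.op 1 a = a := by rw [T.comm, T.op_one]

theorem op_le_left (a b : I) : T.op a b ≤ a := by
  simpa only [T.op_one] using T.mono a b a 1 le_rfl le_top

theorem op_le_right (a b : I) : T.op a b ≤ b := by
  rw [T.comm]; exact T.op_le_left b a

theorem op_zero (a : I) : T.op a 0 = 0 := le_antisymm (T.op_le_right a 0) bot_le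

theorem zero_op (a : I) : T.op 0 a = 0 := le_antisymm (T.op_le_left 0 a) bot_le

theorem mono_left {a b : I} (c : I) (h : a ≤ b) : T.op a c ≤ T.op b c := T.mono _ _ _ _ h le_rfl

theorem mono_right (c : I) {a b : I} (h : a ≤ b) : T.op c a ≤ T.op c b := T.mono _ _ _ _ le_rfl h

theorem continuous_right (a : I) : Continuous (T.op a) :=
  T.continuous_op.comp (continuous_const.prodMk continuous_id)

theorem op_iSup_le {ι : Sort*} {a c : I} {f : ι → I} (h : ∀ i, T.op a (f i) ≤ c) :
    T.op a (⨆ i, f i) ≤ c := by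
  rw [Monotone.map_iSup_of_continuousAt (f := T.op a) (T.continuous_right a).continuousAt
    (fun _ _ => T.mono_right a) (T.op_zero a)]
  exact iSup_le h

theorem iSup_op_le {ι : Sort*} {a c : I} {f : ι → I} (h : ∀ i, T.op (f i) a ≤ c) :
    T.op (⨆ i, f i) a ≤ c := by
  rw [T.comm]
  exact T.op_iSup_le fun i => by rw [T.comm]; exact h i

variable {T}

/-- By the intermediate value theorem $x = e \ast y$ for some $y$, and the extra factor $e$ is
absorbed. -/
theorem op_eq_right_of_idempotent {e x : I} (he : T.op e e = e) (hx : x ≤ e) : T.op e x = x := by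
  obtain ⟨y, hy⟩ : x ∈ range (T.op e) := by
    refine mem_range_of_exists_le_of_exists_ge (T.continuous_right e) ⟨0, ?_⟩ ⟨1, ?_⟩
    · rw [T.op_zero]; exact bot_le
    · rwa [T.op_one]
  rw [← hy, ← T.assoc, he]

/-- (TN1) at $a = b = e$ gives $e \ast (1-e) = 0$. Since $e$ acts as a unit below itself, $\min(e,
1-e) = e \ast \min(e, 1-e) \le e \ast (1-e) = 0$. -/
theorem TN1.eq_zero_or_one_of_idempotent (hT : T.TN1) {e : I} (he : T.op e e = e) :
    e = 0 ∨ e = 1 := by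
  have h := hT e e
  rw [he, sub_self] at h
  have h0 : T.op e (σ e) = 0 := le_antisymm (Subtype.coe_le_coe.1 h) bot_le
  have hm : min e (σ e) ≤ 0 := by
    rw [← op_eq_right_of_idempotent he (min_le_left e (σ e)), ← h0]
    exact T.mono_right e (min_le_right _ _)
  rcases min_le_iff.1 hm with h | h
  · exact Or.inl (le_antisymm h bot_le)
  · right
    rw [← unitInterval.symm_symm e, le_antisymm h bot_le, unitInterval.symm_zero]

/-- The set of $c$ with $a \ast c = a$ is compact and closed under $\ast$, so its least element is
idempotent, hence 0 or 1. The value 0 forces $a = 0$, and 1 forces $b = 1$. -/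
theorem TN1.op_lt_left (hT : T.TN1) {a b : I} (ha : 0 < a) (hb : b < 1) : T.op a b < a := by
  refine lt_of_le_of_ne (T.op_le_left a b) fun hab => ?_
  have hcl : IsClosed {c | T.op a c = a} := isClosed_eq (T.continuous_right a) continuous_const
  obtain ⟨e, he, hle⟩ := hcl.isCompact.exists_isLeast ⟨b, hab⟩
  have he' : T.op a e = a := he
  have hee : T.op e e = e := le_antisymm (T.op_le_left e e)
    (hle (show T.op a (T.op e e) = a by rw [← T.assoc, he', he']))
  rcases hT.eq_zero_or_one_of_idempotent hee with h | h
  · rw [h, T.op_zero] at he'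
    exact ha.ne he'
  · exact (hb.trans_le (h ▸ hle hab : (1 : I) ≤ b)).false

variable (T) in
theorem tendsto_op_symm (a : I) : Tendsto (fun ε => T.op a (σ ε)) (𝓝 0) (𝓝 a) := by
  have h : Continuous fun ε => T.op a (σ ε) :=
    (T.continuous_right a).comp unitInterval.continuous_symm
  simpa [T.op_one] using h.tendsto 0

variable (T) in
theorem tendsto_symm_op_symm : Tendsto (fun ε => T.op (σ ε) (σ ε)) (𝓝 0) (𝓝 1) := by
  have h : Continuous fun ε => T.op (σ ε) (σ ε) :=
    T.continuous_op.comp (unitInterval.continuous_symm.prodMk unitInterval.continuous_symm)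
  simpa [T.op_one] using h.tendsto 0

end ContTNorm

/-! ### The uniformity of a fuzzy pseudometric. -/

namespace FuzzySet

variable {T : ContTNorm} {α : Type*} {F : α → α → ℝ≥0 → I}

/-- Fuzzy pseudometrics: every level is a `T`-equivalence, and the levels increase. -/
structure IsPseudo (T : ContTNorm) (F : α → α → ℝ≥0 → I) : Prop where
  mono : ∀ x y, Monotone (F x y)
  refl : ∀ x t, 0 < t → F x x t = 1
  symm : ∀ x y t, 0 < t → F x y t = F y x t
  trans : ∀ x y z t, 0 < t → T.op (F x y t) (F y z t) ≤ F x z t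

/-- The set of pairs that are `ε`-close at level `t`. -/
def entourage (F : α → α → ℝ≥0 → I) (ε : I) (t : ℝ≥0) : Set (α × α) :=
  {p | σ ε < F p.1 p.2 t}

/-- A sequence of positive numbers less than one that tends to zero. -/
def seqI (n : ℕ) : I :=
  ⟨1 / ((n : ℝ) + 2), by positivity, by
    rw [div_le_one (by positivity)]; linarith [n.cast_nonneg (α := ℝ)]⟩

theorem seqI_pos (n : ℕ) : 0 < seqI n := Subtype.coe_lt_coe.1 (by simp only [seqI]; positivity)

theorem seqI_lt_one (n : ℕ) : seqI n < 1 := Subtype.coe_lt_coe.1 (by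
  simp only [seqI, Icc.coe_one]
  rw [div_lt_one (by positivity)]; linarith [n.cast_nonneg (α := ℝ)])

theorem seqI_anti : Antitone seqI := fun m n h => Subtype.coe_le_coe.1 (by
  simp only [seqI]
  have : (m : ℝ) ≤ n := by exact_mod_cast h
  gcongr)

theorem exists_seqI_lt {ε : I} (h : 0 < ε) : ∃ n, seqI n < ε := by
  obtain ⟨n, hn⟩ := exists_nat_one_div_lt (Subtype.coe_lt_coe.2 h)
  refine ⟨n, Subtype.coe_lt_coe.1 (lt_of_le_of_lt ?_ hn)⟩
  simp only [seqI]
  gcongr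
  norm_num

/-- A sequence of positive levels that tends to zero. -/
def seqT (n : ℕ) : ℝ≥0 := 1 / ((n : ℝ≥0) + 1)

theorem seqT_pos (n : ℕ) : 0 < seqT n := by unfold seqT; positivity

theorem seqT_anti : Antitone seqT := fun m n h => by
  unfold seqT
  have : (m : ℝ≥0) ≤ n := by exact_mod_cast h
  gcongr

theorem exists_seqT_lt {t : ℝ≥0} (h : 0 < t) : ∃ n, seqT n < t := exists_nat_one_div_lt h

theorem entourage_mono (hF : ∀ x y, Monotone (F x y)) {ε ε' : I} {t t' : ℝ≥0} (hε : ε ≤ ε')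
    (ht : t ≤ t') : entourage F ε t ⊆ entourage F ε' t' := fun _ hp =>
  lt_of_le_of_lt (unitInterval.symm_le_symm.2 hε) (lt_of_lt_of_le hp (hF _ _ ht))

/-- A countable base of entourages. -/
def seqEntourage (F : α → α → ℝ≥0 → I) (n : ℕ) : Set (α × α) := entourage F (seqI n) (seqT n)

theorem seqEntourage_anti (hF : ∀ x y, Monotone (F x y)) : Antitone (seqEntourage F) :=
  fun _ _ h => entourage_mono hF (seqI_anti h) (seqT_anti h)

theorem exists_seqEntourage_subset (hF : ∀ x y, Monotone (F x y)) {ε : I} {t : ℝ≥0} (hε : 0 < ε)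
    (ht : 0 < t) : ∃ n, seqEntourage F n ⊆ entourage F ε t := by
  obtain ⟨m, hm⟩ := exists_seqI_lt hε
  obtain ⟨n, hn⟩ := exists_seqT_lt ht
  exact ⟨max m n, entourage_mono hF ((seqI_anti (le_max_left m n)).trans hm.le)
    ((seqT_anti (le_max_right m n)).trans hn.le)⟩

/-- The filter of entourages. -/
def uniformityFilter (F : α → α → ℝ≥0 → I) : Filter (α × α) := ⨅ n, 𝓟 (seqEntourage F n)

theorem hasBasis_uniformityFilter (hF : ∀ x y, Monotone (F x y)) :
    (uniformityFilter F).HasBasis (fun _ : ℕ => True) (seqEntourage F) :=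
  hasBasis_iInf_principal (seqEntourage_anti hF).directed_ge

theorem entourage_mem (hF : ∀ x y, Monotone (F x y)) {ε : I} {t : ℝ≥0} (hε : 0 < ε)
    (ht : 0 < t) : entourage F ε t ∈ uniformityFilter F := by
  obtain ⟨n, hn⟩ := exists_seqEntourage_subset hF hε ht
  exact (hasBasis_uniformityFilter hF).mem_iff.2 ⟨n, trivial, hn⟩

/-- Continuity of $\ast$ at $(1,1)$ replaces halving the radius; the level $t$ need not shrink, by
the strong triangle inequality. -/
theorem IsPseudo.exists_comp_subset (h : IsPseudo T F) {ε : I} {t : ℝ≥0} (hε : 0 < ε)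
    (ht : 0 < t) : ∃ ε', 0 < ε' ∧ ∀ x y z, σ ε' < F x y t → σ ε' < F y z t → σ ε < F x z t := by
  have hlt : σ ε < 1 := by
    rw [← unitInterval.symm_zero]; exact unitInterval.symm_lt_symm.2 hε
  obtain ⟨ε', h0, -, h2⟩ := unitInterval.exists_pos_of_eventually
    (T.tendsto_symm_op_symm.eventually (lt_mem_nhds hlt))
  exact ⟨ε', h0, fun x y z hx hy =>
    h2.trans_le ((T.mono _ _ _ _ hx.le hy.le).trans (h.trans x y z t ht))⟩

/-- The uniform structure of a fuzzy pseudometric. -/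
@[reducible] def IsPseudo.uniformSpace (h : IsPseudo T F) : UniformSpace α :=
  UniformSpace.ofCoreEq
    { uniformity := uniformityFilter F
      refl := by
        refine (hasBasis_uniformityFilter h.mono).ge_iff.2 fun n _ => ?_
        rintro ⟨x, y⟩ hxy
        obtain rfl : x = y := hxy
        show σ (seqI n) < F x x (seqT n)
        rw [h.refl x _ (seqT_pos n), ← unitInterval.symm_zero]
        exact unitInterval.symm_lt_symm.2 (seqI_pos n)
      symm := by
        refine ((hasBasis_uniformityFilter h.mono).tendsto_iff (hasBasis_uniformityFilter h.mono)).2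
          fun n _ => ⟨n, trivial, fun p hp => ?_⟩
        show σ (seqI n) < F p.2 p.1 (seqT n)
        rw [h.symm _ _ _ (seqT_pos n)]
        exact hp
      comp := by
        refine (hasBasis_uniformityFilter h.mono).ge_iff.2 fun n _ => ?_
        obtain ⟨ε', h0, hε'⟩ := h.exists_comp_subset (seqI_pos n) (seqT_pos n)
        refine mem_of_superset (mem_lift' (entourage_mem h.mono h0 (seqT_pos n))) ?_
        rintro ⟨x, z⟩ ⟨y, hxy, hyz⟩
        exact hε' x y z hxy hyz }
    (FuzzySet.topology F h.mono) (by
      ext U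
      have : ∀ x, U ∈ comap (Prod.mk x) (uniformityFilter F) ↔
          ∃ (ε : I) (t : ℝ≥0), 0 < ε ∧ ε < 1 ∧ 0 < t ∧ ball F x ε t ⊆ U := by
        intro x
        rw [((hasBasis_uniformityFilter h.mono).comap (Prod.mk x)).mem_iff]
        constructor
        · rintro ⟨n, -, hn⟩
          exact ⟨seqI n, seqT n, seqI_pos n, seqI_lt_one n, seqT_pos n, hn⟩
        · rintro ⟨ε, t, h0, -, ht, hU⟩
          obtain ⟨n, hn⟩ := exists_seqEntourage_subset h.mono h0 ht
          exact ⟨n, trivial, fun y hy => hU (hn hy)⟩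
      exact forall₂_congr fun x _ => (this x).symm)

end FuzzySet

end

/-! ### Bridges, gluing, and the pseudometric axioms for the Gromov–Hausdorff distance. -/

noncomputable section

theorem unitInterval.continuousWithinAt_Iic_iSup {ι : Sort*} {f : ι → ℝ≥0 → I} {t : ℝ≥0}
    (hm : ∀ i, Monotone (f i)) (hc : ∀ i, ContinuousWithinAt (f i) (Iic t) t) :
    ContinuousWithinAt (fun s => ⨆ i, f i s) (Iic t) t := by
  refine tendsto_order.2 ⟨fun a ha => ?_, fun a ha => ?_⟩
  · obtain ⟨i, hi⟩ := lt_iSup_iff.1 ha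
    filter_upwards [(hc i).eventually (lt_mem_nhds hi)] with s hs
    exact hs.trans_le (le_iSup (fun i => f i s) i)
  · filter_upwards [self_mem_nhdsWithin] with s hs
    exact (iSup_mono fun i => hm i hs).trans_lt ha

theorem ContTNorm.continuousWithinAt_op (T : ContTNorm) {f g : ℝ≥0 → I} {s : Set ℝ≥0} {t : ℝ≥0}
    (hf : ContinuousWithinAt f s t) (hg : ContinuousWithinAt g s t) :
    ContinuousWithinAt (fun r => T.op (f r) (g r)) s t :=
  T.continuous_op.continuousAt.comp_continuousWithinAt (hf.prodMk hg)

namespace NAFuzzyMetric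

variable {T : ContTNorm} {X Y Z : Type*}

theorem isPseudo (m : NAFuzzyMetric T X) : FuzzySet.IsPseudo T m.M where
  mono := m.M_mono
  refl x := (m.eq_one_iff x x).2 rfl
  symm := m.symm
  trans x y z t ht := by simpa using m.nonarch x y z t t ht ht

/-- Cross distances between `X` and `Y` that are compatible with the given fuzzy metrics at all
levels above `t₀`. -/
structure IsBridge (mX : NAFuzzyMetric T X) (mY : NAFuzzyMetric T Y) (K : X → Y → ℝ≥0 → I)
    (t₀ : ℝ≥0) : Prop where
  mono : ∀ x y, Monotone (K x y)
  left_cont : ∀ x y t, ContinuousWithinAt (K x y) (Iic t) t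
  left : ∀ x x' y s, t₀ < s → T.op (mX.M x x' s) (K x' y s) ≤ K x y s
  right : ∀ x y y' s, t₀ < s → T.op (K x y s) (mY.M y y' s) ≤ K x y' s
  comp_left : ∀ x x' y s, t₀ < s → T.op (K x y s) (K x' y s) ≤ mX.M x x' s
  comp_right : ∀ x y y' s, t₀ < s → T.op (K x y s) (K x y' s) ≤ mY.M y y' s

/-- The fuzzy set on `X ⊕ Y` with cross distances `K` above the level `t₀` and `0` below. -/
def glueM (mX : NAFuzzyMetric T X) (mY : NAFuzzyMetric T Y) (K : X → Y → ℝ≥0 → I) (t₀ : ℝ≥0) :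
    X ⊕ Y → X ⊕ Y → ℝ≥0 → I
  | .inl x, .inl x', s => mX.M x x' s
  | .inl x, .inr y, s => if s ≤ t₀ then 0 else K x y s
  | .inr y, .inl x, s => if s ≤ t₀ then 0 else K x y s
  | .inr y, .inr y', s => mY.M y y' s

variable {mX : NAFuzzyMetric T X} {mY : NAFuzzyMetric T Y} {mZ : NAFuzzyMetric T Z}
  {K : X → Y → ℝ≥0 → I} {t₀ : ℝ≥0}

theorem monotone_cut {f : ℝ≥0 → I} (hf : Monotone f) :
    Monotone fun s => if s ≤ t₀ then 0 else f s := by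
  intro s t hst
  dsimp only
  split_ifs with h1 h2 h2
  · exact le_rfl
  · exact bot_le
  · exact absurd (hst.trans h2) h1
  · exact hf hst

theorem left_cont_cut {f : ℝ≥0 → I} {t : ℝ≥0} (hf : ContinuousWithinAt f (Iic t) t) :
    ContinuousWithinAt (fun s => if s ≤ t₀ then 0 else f s) (Iic t) t := by
  rcases le_or_gt t t₀ with h | h
  · refine (continuousWithinAt_const (b := (0 : I))).congr (fun s hs => ?_) ?_
    · exact if_pos (le_trans hs h)
    · exact if_pos h
  · refine hf.congr_of_eventuallyEq ?_ (if_neg h.not_ge)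
    filter_upwards [mem_nhdsWithin_of_mem_nhds (Ioi_mem_nhds h)] with s hs
    exact if_neg (not_le.2 hs)

theorem glueM_mono (h : IsBridge mX mY K t₀) (p q : X ⊕ Y) : Monotone (glueM mX mY K t₀ p q) := by
  rcases p with x | y <;> rcases q with x' | y'
  · exact mX.M_mono _ _
  · exact monotone_cut (h.mono _ _)
  · exact monotone_cut (h.mono _ _)
  · exact mY.M_mono _ _

theorem glueM_symm (mX : NAFuzzyMetric T X) (mY : NAFuzzyMetric T Y) (K : X → Y → ℝ≥0 → I)
    (t₀ : ℝ≥0) (p q : X ⊕ Y) {t : ℝ≥0} (ht : 0 < t) :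
    glueM mX mY K t₀ p q t = glueM mX mY K t₀ q p t := by
  rcases p with x | y <;> rcases q with x' | y'
  · exact mX.symm _ _ _ ht
  · rfl
  · rfl
  · exact mY.symm _ _ _ ht

theorem glueM_trans (h : IsBridge mX mY K t₀) (p q r : X ⊕ Y) {s : ℝ≥0} (hs : 0 < s) :
    T.op (glueM mX mY K t₀ p q s) (glueM mX mY K t₀ q r s) ≤ glueM mX mY K t₀ p r s := by
  rcases le_or_gt s t₀ with h0 | h0
  · rcases p with x | y <;> rcases q with x' | y' <;> rcases r with x'' | y'' <;>
      simp only [glueM, if_pos h0, T.op_zero, T.zero_op, zero_le, le_refl] <;>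
      first
        | exact mX.isPseudo.trans _ _ _ _ hs
        | exact mY.isPseudo.trans _ _ _ _ hs
  · rcases p with x | y <;> rcases q with x' | y' <;> rcases r with x'' | y'' <;>
      simp only [glueM, if_neg h0.not_ge]
    · exact mX.isPseudo.trans _ _ _ _ hs
    · exact h.left _ _ _ _ h0
    · exact h.comp_left _ _ _ _ h0
    · exact h.right _ _ _ _ h0
    · rw [T.comm, mX.symm _ _ _ hs]; exact h.left _ _ _ _ h0
    · exact h.comp_right _ _ _ _ h0
    · rw [T.comm, mY.symm _ _ _ hs]; exact h.right _ _ _ _ h0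
    · exact mY.isPseudo.trans _ _ _ _ hs

/-- The fuzzy metric on the disjoint union that is defined by a bridge. -/
def glue (ht₀ : 0 < t₀) (h : IsBridge mX mY K t₀) : NAFuzzyMetric T (X ⊕ Y) where
  M := glueM mX mY K t₀
  at_zero p q := by
    rcases p with x | y <;> rcases q with x' | y'
    · exact mX.at_zero _ _
    · exact if_pos bot_le
    · exact if_pos bot_le
    · exact mY.at_zero _ _
  eq_one_iff p q := by
    have h01 : (0 : I) ≠ 1 := zero_ne_one
    rcases p with x | y <;> rcases q with x' | y'
    · exact (mX.eq_one_iff x x').trans Sum.inl_injective.eq_iff.symm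
    -- The cut at $t_0 > 0$ keeps points of different summands apart, whatever the bridge is.
    · simpa using ⟨t₀, ht₀, by simp [glueM]⟩
    · simpa using ⟨t₀, ht₀, by simp [glueM]⟩
    · exact (mY.eq_one_iff y y').trans Sum.inr_injective.eq_iff.symm
  symm p q _ ht := glueM_symm mX mY K t₀ p q ht
  nonarch p q r t s ht hs :=
    (T.mono _ _ _ _ (glueM_mono h _ _ (le_max_left t s)) (glueM_mono h _ _ (le_max_right t s))).trans
      (glueM_trans h p q r (lt_max_of_lt_left ht))
  left_cont p q t := by
    rcases p with x | y <;> rcases q with x' | y'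
    · exact mX.left_cont _ _ _
    · exact left_cont_cut (h.left_cont _ _ _)
    · exact left_cont_cut (h.left_cont _ _ _)
    · exact mY.left_cont _ _ _

theorem IsBridge.le_gh (ht₀ : 0 < t₀) (h : IsBridge mX mY K t₀) {t : ℝ≥0} (ht : t₀ < t) {c : I}
    (hX : ∀ x, c ≤ ⨆ y, K x y t) (hY : ∀ y, c ≤ ⨆ x, K x y t) : c ≤ gh mX mY t := by
  refine le_trans ?_ (le_iSup₂ (f := fun (m : NAFuzzyMetric T (X ⊕ Y))
    (_ : IsAdmissible mX mY m) => FuzzySet.hausdorff m.M (range Sum.inl) (range Sum.inr) t)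
    (glue ht₀ h) ⟨fun _ _ _ => rfl, fun _ _ _ => rfl⟩)
  simp only [FuzzySet.hausdorff, iInf_range, iSup_range, glue, glueM, if_neg ht.not_ge]
  exact le_min (le_iInf hX) (le_iInf hY)

/-- With `IsBridge.le_gh` this reduces statements about admissible metrics to bridges, which compose
freely because they need not separate points. -/
theorem IsAdmissible.isBridge {m : NAFuzzyMetric T (X ⊕ Y)} (hm : IsAdmissible mX mY m) :
    IsBridge mX mY (fun x y => m.M (Sum.inl x) (Sum.inr y)) t₀ where
  mono _ _ := m.M_mono _ _
  left_cont _ _ := m.left_cont _ _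
  left x x' y s hs := by
    rw [← hm.1]; exact m.isPseudo.trans _ _ _ _ (bot_le.trans_lt hs)
  right x y y' s hs := by
    rw [← hm.2]; exact m.isPseudo.trans _ _ _ _ (bot_le.trans_lt hs)
  comp_left x x' y s hs := by
    have h0 : 0 < s := bot_le.trans_lt hs
    rw [← hm.1, m.symm (Sum.inl x') _ _ h0]; exact m.isPseudo.trans _ _ _ _ h0
  comp_right x y y' s hs := by
    have h0 : 0 < s := bot_le.trans_lt hs
    rw [← hm.2, m.symm (Sum.inl x) _ _ h0]; exact m.isPseudo.trans _ _ _ _ h0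

theorem IsBridge.symm (h : IsBridge mX mY K t₀) : IsBridge mY mX (fun y x => K x y) t₀ where
  mono _ _ := h.mono _ _
  left_cont _ _ := h.left_cont _ _
  left y y' x s hs := by
    rw [T.comm, mY.symm _ _ _ (bot_le.trans_lt hs)]; exact h.right _ _ _ _ hs
  right y x x' s hs := by
    rw [T.comm, mX.symm _ _ _ (bot_le.trans_lt hs)]; exact h.left _ _ _ _ hs
  comp_left _ _ _ _ hs := h.comp_right _ _ _ _ hs
  comp_right _ _ _ _ hs := h.comp_left _ _ _ _ hs

theorem IsBridge.comp {L : Y → Z → ℝ≥0 → I} (h : IsBridge mX mY K t₀) (h' : IsBridge mY mZ L t₀) :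
    IsBridge mX mZ (fun x z s => ⨆ y, T.op (K x y s) (L y z s)) t₀ where
  mono x z s t hst := iSup_mono fun y => T.mono _ _ _ _ (h.mono x y hst) (h'.mono y z hst)
  left_cont x z t := unitInterval.continuousWithinAt_Iic_iSup
    (fun y _ _ hst => T.mono _ _ _ _ (h.mono x y hst) (h'.mono y z hst))
    fun y => T.continuousWithinAt_op (h.left_cont x y t) (h'.left_cont y z t)
  left x x' z s hs := T.op_iSup_le fun y => by
    rw [← T.assoc]
    exact (T.mono_left _ (h.left x x' y s hs)).trans (le_iSup (fun y => T.op (K x y s) (L y z s)) y)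
  right x z z' s hs := T.iSup_op_le fun y => by
    rw [T.assoc]
    exact (T.mono_right _ (h'.right y z z' s hs)).trans
      (le_iSup (fun y => T.op (K x y s) (L y z' s)) y)
  -- The point $z$ bounds the distance of $y$ and $y'$; this moves $x$ from $y$ to $y'$, where it is
  -- compared with $x'$.
  comp_left x x' z s hs := T.iSup_op_le fun y => T.op_iSup_le fun y' => calc
    T.op (T.op (K x y s) (L y z s)) (T.op (K x' y' s) (L y' z s))
      = T.op (T.op (K x y s) (T.op (L y z s) (L y' z s))) (K x' y' s) := by ac_rfl
    _ ≤ T.op (K x y' s) (K x' y' s) := T.mono_left _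
      ((T.mono_right _ (h'.comp_left y y' z s hs)).trans (h.right x y y' s hs))
    _ ≤ mX.M x x' s := h.comp_left x x' y' s hs
  comp_right x z z' s hs := T.iSup_op_le fun y => T.op_iSup_le fun y' => calc
    T.op (T.op (K x y s) (L y z s)) (T.op (K x y' s) (L y' z' s))
      = T.op (L y z s) (T.op (T.op (K x y s) (K x y' s)) (L y' z' s)) := by ac_rfl
    _ ≤ T.op (L y z s) (L y z' s) := T.mono_right _
      ((T.mono_left _ (h.comp_right x y y' s hs)).trans (h'.left y y' z' s hs))
    _ ≤ mZ.M z z' s := h'.comp_right y z z' s hs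

/-- Uncut, this would identify the two copies of each point, so it comes from no admissible metric;
cut at arbitrarily small levels it still gives `gh_self`. -/
theorem isBridge_self (mX : NAFuzzyMetric T X) : IsBridge mX mX mX.M t₀ where
  mono := mX.M_mono
  left_cont := mX.left_cont
  left _ _ _ _ hs := mX.isPseudo.trans _ _ _ _ (bot_le.trans_lt hs)
  right _ _ _ _ hs := mX.isPseudo.trans _ _ _ _ (bot_le.trans_lt hs)
  comp_left x x' y s hs := by
    rw [mX.symm x' y s (bot_le.trans_lt hs)]; exact mX.isPseudo.trans _ _ _ _ (bot_le.trans_lt hs)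
  comp_right x y y' s hs := by
    rw [mX.symm x y s (bot_le.trans_lt hs)]; exact mX.isPseudo.trans _ _ _ _ (bot_le.trans_lt hs)

theorem gh_self (mX : NAFuzzyMetric T X) {t : ℝ≥0} (ht : 0 < t) : gh mX mX t = 1 := by
  have h (x : X) : (1 : I) ≤ mX.M x x t := (mX.isPseudo.refl x t ht).ge
  exact le_antisymm le_top ((isBridge_self mX).le_gh (half_pos ht) (NNReal.half_lt_self ht.ne')
    (fun x => (h x).trans (le_iSup (fun y => mX.M x y t) x))
    fun x => (h x).trans (le_iSup (fun y => mX.M y x t) x))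

theorem hausdorff_sum (m : NAFuzzyMetric T (X ⊕ Y)) (t : ℝ≥0) :
    FuzzySet.hausdorff m.M (range Sum.inl) (range Sum.inr) t =
      min (⨅ x, ⨆ y, m.M (Sum.inl x) (Sum.inr y) t) (⨅ y, ⨆ x, m.M (Sum.inl x) (Sum.inr y) t) := by
  simp only [FuzzySet.hausdorff, iInf_range, iSup_range]

theorem hausdorff_sum_le_left (m : NAFuzzyMetric T (X ⊕ Y)) (t : ℝ≥0) (x : X) :
    FuzzySet.hausdorff m.M (range Sum.inl) (range Sum.inr) t ≤
      ⨆ y, m.M (Sum.inl x) (Sum.inr y) t := by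
  rw [hausdorff_sum]; exact (min_le_left _ _).trans (iInf_le _ x)

theorem hausdorff_sum_le_right (m : NAFuzzyMetric T (X ⊕ Y)) (t : ℝ≥0) (y : Y) :
    FuzzySet.hausdorff m.M (range Sum.inl) (range Sum.inr) t ≤
      ⨆ x, m.M (Sum.inl x) (Sum.inr y) t := by
  rw [hausdorff_sum]; exact (min_le_right _ _).trans (iInf_le _ y)

theorem gh_le_gh_swap (mX : NAFuzzyMetric T X) (mY : NAFuzzyMetric T Y) {t : ℝ≥0} (ht : 0 < t) :
    gh mX mY t ≤ gh mY mX t :=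
  iSup₂_le fun m hm => hm.isBridge.symm.le_gh (half_pos ht) (NNReal.half_lt_self ht.ne')
    (hausdorff_sum_le_right m t) (hausdorff_sum_le_left m t)

/-- Since $\ast$ is continuous and monotone it commutes with suprema, so one pair of admissible
metrics can be fixed and their bridges composed, with the cut at $t/2$. -/
theorem gh_triangle (mX : NAFuzzyMetric T X) (mY : NAFuzzyMetric T Y) (mZ : NAFuzzyMetric T Z)
    {t : ℝ≥0} (ht : 0 < t) : T.op (gh mX mY t) (gh mY mZ t) ≤ gh mX mZ t := by
  refine T.iSup_op_le fun m => T.iSup_op_le fun hm => T.op_iSup_le fun m' => T.op_iSup_le fun hm' =>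
    (hm.isBridge.comp hm'.isBridge).le_gh (half_pos ht) (NNReal.half_lt_self ht.ne')
      (fun x => ?_) (fun z => ?_)
  · refine (T.mono_left _ (hausdorff_sum_le_left m t x)).trans (T.iSup_op_le fun y => ?_)
    refine (T.mono_right _ (hausdorff_sum_le_left m' t y)).trans (T.op_iSup_le fun z => ?_)
    exact le_iSup_of_le z (le_iSup (fun y => T.op (m.M (.inl x) (.inr y) t) (m'.M (.inl y) (.inr z) t)) y)
  · refine (T.mono_right _ (hausdorff_sum_le_right m' t z)).trans (T.op_iSup_le fun y => ?_)
    refine (T.mono_left _ (hausdorff_sum_le_right m t y)).trans (T.iSup_op_le fun x => ?_)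
    exact le_iSup_of_le x (le_iSup (fun y => T.op (m.M (.inl x) (.inr y) t) (m'.M (.inl y) (.inr z) t)) y)

/-- Two families of points with nearly equal mutual distances above `t₀` define a bridge. -/
theorem isBridge_of_nets {ι : Type*} {a : ι → X} {b : ι → Y} {δ : I}
    (hXY : ∀ i j s, t₀ < s → T.op (mX.M (a i) (a j) s) δ ≤ mY.M (b i) (b j) s)
    (hYX : ∀ i j s, t₀ < s → T.op (mY.M (b i) (b j) s) δ ≤ mX.M (a i) (a j) s) :
    IsBridge mX mY (fun x y s => ⨆ i, T.op (T.op (mX.M x (a i) s) (mY.M (b i) y s)) δ) t₀ where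
  mono x y s t hst := iSup_mono fun i =>
    T.mono_left _ (T.mono _ _ _ _ (mX.M_mono _ _ hst) (mY.M_mono _ _ hst))
  left_cont x y t := unitInterval.continuousWithinAt_Iic_iSup
    (fun i _ _ hst => T.mono_left _ (T.mono _ _ _ _ (mX.M_mono _ _ hst) (mY.M_mono _ _ hst)))
    fun i => T.continuousWithinAt_op
      (T.continuousWithinAt_op (mX.left_cont _ _ _) (mY.left_cont _ _ _)) continuousWithinAt_const
  left x x' y s hs := T.op_iSup_le fun i => by
    rw [← T.assoc, ← T.assoc]
    exact le_iSup_of_le i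
      (T.mono_left _ (T.mono_left _ (mX.isPseudo.trans _ _ _ _ (bot_le.trans_lt hs))))
  right x y y' s hs := T.iSup_op_le fun i => by
    refine le_iSup_of_le i ?_
    calc T.op (T.op (T.op (mX.M x (a i) s) (mY.M (b i) y s)) δ) (mY.M y y' s)
        = T.op (T.op (mX.M x (a i) s) (T.op (mY.M (b i) y s) (mY.M y y' s))) δ := by ac_rfl
      _ ≤ _ := T.mono_left _ (T.mono_right _ (mY.isPseudo.trans _ _ _ _ (bot_le.trans_lt hs)))
  -- One factor $\delta$ is discarded; the other pays for replacing the distance of $b_i, b_j$,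
  -- bounded through $y$, by that of $a_i, a_j$.
  comp_left x x' y s hs := T.iSup_op_le fun i => T.op_iSup_le fun j => by
    have h0 : 0 < s := bot_le.trans_lt hs
    have hX := mX.isPseudo.trans
    calc T.op (T.op (T.op (mX.M x (a i) s) (mY.M (b i) y s)) δ)
          (T.op (T.op (mX.M x' (a j) s) (mY.M (b j) y s)) δ)
        = T.op δ (T.op (T.op (mX.M x (a i) s) (T.op (T.op (mY.M (b i) y s) (mY.M (b j) y s)) δ))
          (mX.M x' (a j) s)) := by ac_rfl
      _ ≤ T.op (T.op (mX.M x (a i) s) (T.op (T.op (mY.M (b i) y s) (mY.M (b j) y s)) δ))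
          (mX.M x' (a j) s) := T.op_le_right _ _
      _ ≤ T.op (T.op (mX.M x (a i) s) (mX.M (a i) (a j) s)) (mX.M x' (a j) s) := by
          refine T.mono_left _ (T.mono_right _ ((T.mono_left _ ?_).trans (hYX i j s hs)))
          rw [mY.symm (b j) y s h0]
          exact mY.isPseudo.trans _ _ _ _ h0
      _ ≤ mX.M x x' s := by
          rw [mX.symm x' _ s h0]
          exact (T.mono_left _ (hX _ _ _ _ h0)).trans (hX _ _ _ _ h0)
  comp_right x y y' s hs := T.iSup_op_le fun i => T.op_iSup_le fun j => by
    have h0 : 0 < s := bot_le.trans_lt hs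
    have hY := mY.isPseudo.trans
    calc T.op (T.op (T.op (mX.M x (a i) s) (mY.M (b i) y s)) δ)
          (T.op (T.op (mX.M x (a j) s) (mY.M (b j) y' s)) δ)
        = T.op δ (T.op (T.op (mY.M (b i) y s) (T.op (T.op (mX.M x (a i) s) (mX.M x (a j) s)) δ))
          (mY.M (b j) y' s)) := by ac_rfl
      _ ≤ T.op (T.op (mY.M (b i) y s) (T.op (T.op (mX.M x (a i) s) (mX.M x (a j) s)) δ))
          (mY.M (b j) y' s) := T.op_le_right _ _
      _ ≤ T.op (T.op (mY.M (b i) y s) (mY.M (b i) (b j) s)) (mY.M (b j) y' s) := by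
          refine T.mono_left _ (T.mono_right _ ((T.mono_left _ ?_).trans (hXY i j s hs)))
          rw [mX.symm x (a i) s h0]
          exact mX.isPseudo.trans _ _ _ _ h0
      _ ≤ mY.M y y' s := by
          rw [mY.symm _ y s h0]
          exact (T.mono_left _ (hY _ _ _ _ h0)).trans (hY _ _ _ _ h0)

/-- A point near $a_i$ is matched with $b_i$, and conversely: one factor $\delta$ is the net error,
the other the one built into the bridge. -/
theorem le_gh_of_nets {ι : Type*} {a : ι → X} {b : ι → Y} {δ : I} (ht₀ : 0 < t₀)
    (hXY : ∀ i j s, t₀ < s → T.op (mX.M (a i) (a j) s) δ ≤ mY.M (b i) (b j) s)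
    (hYX : ∀ i j s, t₀ < s → T.op (mY.M (b i) (b j) s) δ ≤ mX.M (a i) (a j) s)
    {t : ℝ≥0} (ht : t₀ < t) (ha : ∀ x, ∃ i, δ ≤ mX.M x (a i) t) (hb : ∀ y, ∃ i, δ ≤ mY.M y (b i) t) :
    T.op δ δ ≤ gh mX mY t := by
  have h0 : 0 < t := bot_le.trans_lt ht
  refine (isBridge_of_nets hXY hYX).le_gh ht₀ ht (fun x => ?_) (fun y => ?_)
  · obtain ⟨i, hi⟩ := ha x
    refine le_iSup_of_le (b i) (le_iSup_of_le i (T.mono_left _ ?_))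
    rwa [mY.isPseudo.refl _ _ h0, T.op_one]
  · obtain ⟨i, hi⟩ := hb y
    refine le_iSup_of_le (a i) (le_iSup_of_le i (T.mono_left _ ?_))
    rwa [mX.isPseudo.refl _ _ h0, T.one_op, mY.symm _ _ _ h0]

end NAFuzzyMetric

namespace FuzzyGHSpace

variable {T : ContTNorm}

theorem isPseudo_ghM : FuzzySet.IsPseudo T (ghM (T := T)) where
  mono := ghM_mono
  refl p t ht := by
    induction p using Quotient.ind
    exact NAFuzzyMetric.gh_self _ ht
  symm p q t ht := by
    induction p using Quotient.ind
    induction q using Quotient.ind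
    exact le_antisymm (NAFuzzyMetric.gh_le_gh_swap _ _ ht) (NAFuzzyMetric.gh_le_gh_swap _ _ ht)
  trans p q r t ht := by
    induction p using Quotient.ind
    induction q using Quotient.ind
    induction r using Quotient.ind
    exact NAFuzzyMetric.gh_triangle _ _ _ ht

end FuzzyGHSpace

end

/-! ### Completeness, left regularization and separation of fuzzy pseudometrics. -/

noncomputable section

namespace FuzzySet

variable {T : ContTNorm} {α : Type*} {F : α → α → ℝ≥0 → I}

theorem IsPseudo.tendsto_nhds_iff (h : IsPseudo T F) {ι : Type*} {l : Filter ι} {u : ι → α} {a : α} :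
    Tendsto u l (@nhds α (FuzzySet.topology F h.mono) a) ↔
      ∀ n, ∀ᶠ k in l, σ (seqI n) < F a (u k) (seqT n) := by
  let := h.uniformSpace
  have hb : (𝓝 a).HasBasis (fun _ : ℕ => True) fun n => Prod.mk a ⁻¹' seqEntourage F n := by
    rw [nhds_eq_comap_uniformity]
    exact (hasBasis_uniformityFilter h.mono).comap _
  exact hb.tendsto_right_iff.trans ⟨fun H n => H n trivial, fun H n _ => H n⟩

theorem IsPseudo.isCountablyGenerated (h : IsPseudo T F) :
    (@uniformity α h.uniformSpace).IsCountablyGenerated :=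
  (hasBasis_uniformityFilter h.mono).isCountablyGenerated

/-- A complete and totally bounded fuzzy pseudometric is compact. -/
theorem IsPseudo.compactSpace (h : IsPseudo T F)
    (hc : ∀ u : ℕ → α, (∀ N k l, N ≤ k → N ≤ l → σ (seqI N) < F (u k) (u l) (seqT N)) →
      ∃ a, ∀ n, ∀ᶠ k in atTop, σ (seqI n) < F a (u k) (seqT n))
    (htb : ∀ n, ∃ s : Set α, s.Finite ∧ IsNet F (seqT n) (seqI n) s) :
    @CompactSpace α (FuzzySet.topology F h.mono) := by
  let := h.uniformSpace
  have := h.isCountablyGenerated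
  have : CompleteSpace α := by
    refine UniformSpace.complete_of_convergent_controlled_sequences (seqEntourage F)
      (fun n => (hasBasis_uniformityFilter h.mono).mem_of_mem trivial) fun u hu => ?_
    obtain ⟨a, ha⟩ := hc u hu
    exact ⟨a, h.tendsto_nhds_iff.2 ha⟩
  refine ⟨isCompact_iff_totallyBounded_isComplete.2 ⟨?_, completeSpace_iff_isComplete_univ.1 this⟩⟩
  have hb : (uniformity α).HasBasis (fun _ : ℕ => True) (seqEntourage F) :=
    hasBasis_uniformityFilter h.mono
  refine hb.totallyBounded_iff.2 fun n _ => ?_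
  obtain ⟨s, hs, hn⟩ := htb n
  refine ⟨s, hs, fun x _ => ?_⟩
  obtain ⟨y, hy, hxy⟩ := hn x
  exact mem_biUnion hy hxy

/-- The left-continuous regularization of a fuzzy set. -/
def leftReg (F : α → α → ℝ≥0 → I) (x y : α) (t : ℝ≥0) : I := ⨆ s : Iio t, F x y s

theorem le_leftReg (F : α → α → ℝ≥0 → I) (x y : α) {s t : ℝ≥0} (h : s < t) :
    F x y s ≤ leftReg F x y t := le_iSup (fun s : Iio t => F x y s) ⟨s, h⟩

theorem leftReg_le (hF : ∀ x y, Monotone (F x y)) (x y : α) (t : ℝ≥0) :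
    leftReg F x y t ≤ F x y t := iSup_le fun s => hF x y s.2.le

theorem leftReg_zero (F : α → α → ℝ≥0 → I) (x y : α) : leftReg F x y 0 = 0 :=
  le_antisymm (iSup_le fun s => absurd s.2 (not_lt_bot (a := (s : ℝ≥0)))) bot_le

theorem leftReg_mono (F : α → α → ℝ≥0 → I) (x y : α) : Monotone (leftReg F x y) :=
  fun _ _ h => iSup_le fun s => le_leftReg F x y (lt_of_lt_of_le s.2 h)

theorem leftReg_left_cont (F : α → α → ℝ≥0 → I) (x y : α) (t : ℝ≥0) :
    ContinuousWithinAt (leftReg F x y) (Iic t) t := by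
  refine tendsto_order.2 ⟨fun a ha => ?_, fun a ha => ?_⟩
  · obtain ⟨s, hs⟩ := lt_iSup_iff.1 ha
    filter_upwards [mem_nhdsWithin_of_mem_nhds (Ioi_mem_nhds s.2)] with r hr
    exact hs.trans_le (le_leftReg F x y hr)
  · filter_upwards [self_mem_nhdsWithin] with s hs
    exact (leftReg_mono F x y hs).trans_lt ha

/-- A pointwise ultralimit of left-continuous functions is monotone but need not be left continuous,
hence the regularization. -/
theorem IsPseudo.leftReg (h : IsPseudo T F) : IsPseudo T (leftReg F) where
  mono := leftReg_mono F
  refl x t ht := le_antisymm le_top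
    ((h.refl x _ (half_pos ht)).ge.trans (le_leftReg F x x (NNReal.half_lt_self ht.ne')))
  symm x y t ht := by
    have key (x y) : FuzzySet.leftReg F x y t ≤ FuzzySet.leftReg F y x t := iSup_le fun s => by
      -- The index $s < t$ may be 0, where symmetry is not available; raising it to at least $t/2$
      -- keeps it below $t$.
      have h0 : 0 < max (s : ℝ≥0) (t / 2) := lt_max_of_lt_right (half_pos ht)
      refine (h.mono x y (le_max_left (s : ℝ≥0) (t / 2))).trans ?_
      rw [h.symm x y _ h0]
      exact le_leftReg F y x (max_lt s.2 (NNReal.half_lt_self ht.ne'))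
    exact le_antisymm (key x y) (key y x)
  trans x y z t ht := T.iSup_op_le fun s => T.op_iSup_le fun s' => by
    set r := max (max (s : ℝ≥0) s') (t / 2)
    have h0 : 0 < r := lt_max_of_lt_right (half_pos ht)
    have h1 : r < t := max_lt (max_lt s.2 s'.2) (NNReal.half_lt_self ht.ne')
    exact (T.mono _ _ _ _ (h.mono x y ((le_max_left _ _).trans (le_max_left _ _)))
      (h.mono y z ((le_max_right _ _).trans (le_max_left _ _)))).trans
        ((h.trans x y z r h0).trans (le_leftReg F x z h1))

/-- Points at distance zero. -/
@[reducible] def IsPseudo.setoid (h : IsPseudo T F) : Setoid α where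
  r x y := ∀ t, 0 < t → F x y t = 1
  iseqv :=
    { refl := h.refl
      symm := fun hxy t ht => (h.symm _ _ t ht).trans (hxy t ht)
      trans := fun {x y z} hxy hyz t ht => le_antisymm le_top (by
        have := h.trans x y z t ht
        rwa [hxy t ht, hyz t ht, T.op_one] at this) }

theorem IsPseudo.le_of_setoid (h : IsPseudo T F) {x y x' y' : α} (hx : h.setoid x x')
    (hy : h.setoid y y') {t : ℝ≥0} (ht : 0 < t) : F x y t ≤ F x' y' t := by
  have h1 := h.trans x y y' t ht
  rw [hy t ht, T.op_one] at h1
  have h2 := h.trans x' x y' t ht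
  rw [h.symm x' x t ht, hx t ht, T.one_op] at h2
  exact h1.trans h2

/-- The fuzzy metric on the separation quotient of a left-continuous fuzzy pseudometric. -/
def IsPseudo.separation (h : IsPseudo T F) (h0 : ∀ x y, F x y 0 = 0)
    (hl : ∀ x y t, ContinuousWithinAt (F x y) (Iic t) t) :
    NAFuzzyMetric T (Quotient h.setoid) where
  M := Quotient.lift₂ F (by
    intro x y x' y' hx hy
    funext t
    rcases eq_or_lt_of_le (zero_le : 0 ≤ t) with rfl | ht
    · rw [h0, h0]
    · exact le_antisymm (h.le_of_setoid hx hy ht)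
        (h.le_of_setoid (h.setoid.symm hx) (h.setoid.symm hy) ht))
  at_zero p q := by
    induction p using Quotient.ind
    induction q using Quotient.ind
    exact h0 _ _
  eq_one_iff p q := by
    induction p using Quotient.ind
    induction q using Quotient.ind
    exact ⟨fun H => Quotient.sound (s := h.setoid) H, fun H => Quotient.exact (s := h.setoid) H⟩
  symm p q t ht := by
    induction p using Quotient.ind
    induction q using Quotient.ind
    exact h.symm _ _ _ ht
  nonarch p q r t s ht hs := by
    induction p using Quotient.ind
    induction q using Quotient.ind
    induction r using Quotient.ind
    exact (T.mono _ _ _ _ (h.mono _ _ (le_max_left t s)) (h.mono _ _ (le_max_right t s))).trans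
      (h.trans _ _ _ _ (lt_max_of_lt_left ht))
  left_cont p q t := by
    induction p using Quotient.ind
    induction q using Quotient.ind
    exact hl _ _ _

end FuzzySet

/-! ### Ultraproducts of fuzzy metric spaces. -/

namespace NAFuzzyMetric

open FuzzySet

variable {T : ContTNorm} {X : ℕ → Type*} (m : ∀ n, NAFuzzyMetric T (X n))

/-- The limit of a sequence of fuzzy metrics along a nonprincipal ultrafilter. -/
def ulim (x y : ∀ n, X n) (t : ℝ≥0) : I :=
  ((hyperfilter ℕ).map fun n => (m n).M (x n) (y n) t).lim

theorem tendsto_ulim (x y : ∀ n, X n) (t : ℝ≥0) :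
    Tendsto (fun n => (m n).M (x n) (y n) t) (hyperfilter ℕ) (𝓝 (ulim m x y t)) :=
  Ultrafilter.le_nhds_lim _

theorem isPseudo_ulim : IsPseudo T (ulim m) where
  mono x y _ _ hst := le_of_tendsto_of_tendsto' (tendsto_ulim m x y _) (tendsto_ulim m x y _)
    fun n => (m n).M_mono _ _ hst
  refl x t ht := tendsto_nhds_unique (tendsto_ulim m x x t) (by
    simp only [(m _).isPseudo.refl _ t ht, tendsto_const_nhds])
  symm x y t ht := tendsto_nhds_unique (tendsto_ulim m x y t) (by
    simp only [(m _).symm (x _) _ t ht]; exact tendsto_ulim m y x t)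
  trans x y z t ht := le_of_tendsto_of_tendsto'
    ((T.continuous_op.tendsto _).comp ((tendsto_ulim m x y t).prodMk_nhds (tendsto_ulim m y z t)))
    (tendsto_ulim m x z t) fun n => (m n).isPseudo.trans _ _ _ t ht

/-- The ultraproduct of a sequence of fuzzy metric spaces. -/
abbrev Ultraproduct : Type _ := Quotient (isPseudo_ulim m).leftReg.setoid

/-- The fuzzy metric of the ultraproduct. -/
def ultraproduct : NAFuzzyMetric T (Ultraproduct m) :=
  (isPseudo_ulim m).leftReg.separation (leftReg_zero _) (leftReg_left_cont _)

theorem ultraproduct_mk (x y : ∀ n, X n) (t : ℝ≥0) :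
    (ultraproduct m).M (Quotient.mk _ x) (Quotient.mk _ y) t = leftReg (ulim m) x y t := rfl

/-- Countable saturation of the ultraproduct: for each $K$ the first $K$ Cauchy conditions hold for
ultrafilter-many $n$, so a diagonal sequence can follow $x_K$ with $K$ growing with $n$. -/
theorem exists_ulim_diagonal (x : ℕ → ∀ n, X n)
    (hx : ∀ N k l, N ≤ k → N ≤ l → σ (seqI N) < ulim m (x k) (x l) (seqT N)) :
    ∃ y, ∀ N k, N ≤ k → σ (seqI N) ≤ ulim m (x k) y (seqT N) := by
  classical
  let p : ℕ → ℕ → Prop := fun K n => ∀ k ∈ Iic K, ∀ l ∈ Iic K, ∀ N ∈ Iic K, N ≤ k → N ≤ l →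
    σ (seqI N) < (m n).M (x k n) (x l n) (seqT N)
  have hp (K : ℕ) : ∀ᶠ n in hyperfilter ℕ, p K n := by
    refine (eventually_all_finite (finite_Iic K)).2 fun k _ =>
      (eventually_all_finite (finite_Iic K)).2 fun l _ =>
        (eventually_all_finite (finite_Iic K)).2 fun N _ => ?_
    by_cases hk : N ≤ k
    · by_cases hl : N ≤ l
      · filter_upwards [(tendsto_ulim m (x k) (x l) (seqT N)).eventually
          (lt_mem_nhds (hx N k l hk hl))] with n hn _ _ using hn
      · exact Eventually.of_forall fun n _ h => absurd h hl
    · exact Eventually.of_forall fun n h => absurd h hk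
  -- In coordinate $n$ the largest $K \le n$ with $p\,K\,n$ is used. For fixed $k$ it is at least
  -- $k$ for ultrafilter-many $n$, as these satisfy $p\,k\,n$ and $n \ge k$.
  refine ⟨fun n => x (Nat.findGreatest (fun K => p K n) n) n, fun N k hN => ?_⟩
  refine ge_of_tendsto (tendsto_ulim m _ _ _) ?_
  filter_upwards [hp k, Nat.hyperfilter_le_atTop (eventually_ge_atTop k)] with n hn hkn
  have hle : k ≤ Nat.findGreatest (fun K => p K n) n := Nat.le_findGreatest hkn hn
  exact (Nat.findGreatest_spec (P := fun K => p K n) hkn hn k hle _ (mem_Iic.2 le_rfl) N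
    (hN.trans hle) hN (hN.trans hle)).le

/-- If every index failed in the limit, then, the index set being finite and the same for all $n$,
all would fail at once in some $X_n$, against the net property there. -/
theorem exists_ulim_net {N : ℕ} {t : ℝ≥0} {ε : I} {a : ∀ n, Fin N → X n}
    (ha : ∀ n, IsNet (m n).M t ε (range (a n))) (y : ∀ n, X n) :
    ∃ i, σ ε ≤ ulim m y (fun n => a n i) t := by
  by_contra! H
  have H' : ∀ᶠ n in hyperfilter ℕ, ∀ i, (m n).M (y n) (a n i) t < σ ε :=
    eventually_all.2 fun i => (tendsto_ulim m y (fun n => a n i) t).eventually (gt_mem_nhds (H i))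
  obtain ⟨n, hn⟩ := H'.exists
  obtain ⟨_, ⟨i, rfl⟩, hi⟩ := ha n (y n)
  exact (hi.trans (hn i)).false

theorem compactSpace_ultraproduct
    (h : ∀ (t : ℝ≥0) (ε : I), 0 < t → 0 < ε → ε < 1 → ∃ (N : ℕ) (a : ∀ n, Fin N → X n),
      ∀ n, IsNet (m n).M t ε (range (a n))) :
    @CompactSpace (Ultraproduct m) (ultraproduct m).topology := by
  refine (ultraproduct m).isPseudo.compactSpace (fun u hu => ?_) fun n => ?_
  · obtain ⟨y, hy⟩ := exists_ulim_diagonal m (fun k => (u k).out) fun N k l hk hl => by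
      have := hu N k l hk hl
      rw [← Quotient.out_eq (u k), ← Quotient.out_eq (u l), ultraproduct_mk] at this
      exact this.trans_le (leftReg_le (isPseudo_ulim m).mono _ _ _)
    refine ⟨Quotient.mk _ y, fun n => ?_⟩
    -- A strictly smaller radius makes up for the non-strict inequality in the limit, a strictly
    -- smaller level for the left regularization.
    obtain ⟨N₁, h₁⟩ := exists_seqI_lt (seqI_pos n)
    obtain ⟨N₂, h₂⟩ := exists_seqT_lt (seqT_pos n)
    filter_upwards [eventually_ge_atTop (max N₁ N₂)] with k hk
    rw [(ultraproduct m).symm _ _ _ (seqT_pos n), ← Quotient.out_eq (u k), ultraproduct_mk]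
    refine lt_of_lt_of_le (unitInterval.symm_lt_symm.2
      ((seqI_anti (le_max_left N₁ N₂)).trans_lt h₁)) ((hy _ k hk).trans ?_)
    exact le_leftReg _ _ _ ((seqT_anti (le_max_right N₁ N₂)).trans_lt h₂)
  · obtain ⟨k, hk⟩ := exists_seqI_lt (seqI_pos n)
    obtain ⟨N, a, ha⟩ := h (seqT n / 2) (seqI k) (half_pos (seqT_pos n)) (seqI_pos k) (seqI_lt_one k)
    refine ⟨range fun i => Quotient.mk _ fun n => a n i, finite_range _, fun q => ?_⟩
    obtain ⟨y, rfl⟩ := Quotient.exists_rep q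
    obtain ⟨i, hi⟩ := exists_ulim_net m ha y
    exact ⟨_, ⟨i, rfl⟩, (unitInterval.symm_lt_symm.2 hk).trans_le
      (hi.trans (le_leftReg _ _ _ (NNReal.half_lt_self (seqT_pos n).ne')))⟩

/-- If the mutual distances of nets in `Xₙ` are nearly independent of `n`, then `Xₙ` is close to
the ultraproduct. -/
theorem le_gh_ultraproduct {ι : Type*} {a : ∀ n, ι → X n} {δ : I} {t₀ t : ℝ≥0} (ht₀ : 0 < t₀)
    (ht : t₀ < t) {n : ℕ} (hn : ∀ y, ∃ i, δ ≤ (m n).M y (a n i) t₀)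
    (hu : ∀ y : ∀ n, X n, ∃ i, δ ≤ ulim m y (fun n => a n i) t₀)
    (h₁ : ∀ᶠ k in hyperfilter ℕ, ∀ i j s, t₀ < s →
      T.op ((m k).M (a k i) (a k j) s) δ ≤ (m n).M (a n i) (a n j) s)
    (h₂ : ∀ᶠ k in hyperfilter ℕ, ∀ i j s, t₀ < s →
      T.op ((m n).M (a n i) (a n j) s) δ ≤ (m k).M (a k i) (a k j) s) :
    T.op δ δ ≤ gh (m n) (ultraproduct m) t := by
  refine le_gh_of_nets (a := a n) (b := fun i => Quotient.mk _ fun n => a n i) ht₀ ?_ ?_ ht ?_ ?_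
  · intro i j s hs
    rw [ultraproduct_mk]
    -- The regularized limit at $s$ only dominates the ultralimit at levels $r < s$, so the bound is
    -- proved for $t_0 < r < s$ and left continuity of $M_n$ lets $r \to s$.
    have hlim : Tendsto (fun r => T.op ((m n).M (a n i) (a n j) r) δ) (𝓝[<] s)
        (𝓝 (T.op ((m n).M (a n i) (a n j) s) δ)) :=
      (T.continuousWithinAt_op ((m n).left_cont _ _ s) continuousWithinAt_const).mono_left
        (nhdsWithin_mono _ Iio_subset_Iic_self)
    have : (𝓝[<] s).NeBot := nhdsLT_neBot_of_exists_lt ⟨t₀, hs⟩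
    refine le_of_tendsto hlim ?_
    filter_upwards [self_mem_nhdsWithin, mem_nhdsWithin_of_mem_nhds (Ioi_mem_nhds hs)] with r hr hr'
    refine le_trans ?_ (le_leftReg _ _ _ hr)
    exact ge_of_tendsto (tendsto_ulim m _ _ r) (h₂.mono fun k hk => hk i j r hr')
  · intro i j s hs
    rw [ultraproduct_mk]
    refine (T.mono_left δ (leftReg_le (isPseudo_ulim m).mono _ _ s)).trans ?_
    exact le_of_tendsto (((T.continuous_op.comp (continuous_id.prodMk continuous_const)).tendsto
      _).comp (tendsto_ulim m _ _ s)) (h₁.mono fun k hk => hk i j s hs)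
  · intro x
    obtain ⟨i, hi⟩ := hn x
    exact ⟨i, hi.trans ((m n).M_mono _ _ ht.le)⟩
  · intro q
    obtain ⟨y, rfl⟩ := Quotient.exists_rep q
    obtain ⟨i, hi⟩ := hu y
    exact ⟨i, hi.trans (le_leftReg _ _ _ ht)⟩

end NAFuzzyMetric

end

/-! ### Convergence to the ultraproduct. -/

noncomputable section

/-- The strict inequality $L \ast b < L$ leaves room for a threshold $c$ that does not depend on
$n$, so that $f(n') \ast b < c < f(n)$ compares any two of the indices concerned. -/
theorem ContTNorm.TN1.eventually_op_le {T : ContTNorm} (hT : T.TN1) {b L : I} (hb : b < 1) (hL : 0 < L)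
    {f : ℕ → I} {l : Filter ℕ} (hf : Tendsto f l (𝓝 L)) :
    ∃ c, ∀ᶠ n in l, T.op (f n) b < c ∧ c < f n := by
  obtain ⟨c, h₁, h₂⟩ := exists_between (hT.op_lt_left hL hb)
  have hcont : Continuous fun x => T.op x b :=
    T.continuous_op.comp (continuous_id.prodMk continuous_const)
  exact ⟨c, (((hcont.tendsto L).comp hf).eventually (gt_mem_nhds h₁)).and
    (hf.eventually (lt_mem_nhds h₂))⟩

namespace FuzzyGHSpace

open FuzzySet NAFuzzyMetric

variable {T : ContTNorm}

/-- The primed values belong to the level $t_0$, the others to $s > t_0$. A quotient at least 1 at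
$t_0$ stays so at $s$; where the quotient condition says nothing, $b \le a$ already suffices. -/
theorem op_le_of_quotient_le {a a' b b' δ : I} (h₀ : T.op b' δ ≠ 0) (hle : T.op b' δ ≤ a')
    (hab : a < b → (a' : ℝ) / T.op b' δ ≤ (a : ℝ) / T.op b δ) : T.op b δ ≤ a := by
  rcases lt_or_ge a b with h | h
  · have hpos : (0 : ℝ) < T.op b' δ := lt_of_le_of_ne (T.op b' δ).2.1 fun h => h₀ (Subtype.ext h.symm)
    have h1 : (1 : ℝ) ≤ (a : ℝ) / T.op b δ :=
      ((one_le_div hpos).2 (Subtype.coe_le_coe.2 hle)).trans (hab h)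
    have hne : (T.op b δ : ℝ) ≠ 0 := fun h0 => by
      rw [h0, div_zero] at h1
      exact absurd h1 (by norm_num)
    exact Subtype.coe_le_coe.1 ((one_le_div (lt_of_le_of_ne (T.op b δ).2.1 hne.symm)).1 h1)
  · exact (T.op_le_left b δ).trans h

/-- A sequence with the quotient condition and diameters bounded away from zero converges to its
ultraproduct along the ultrafilter. -/
theorem exists_tendsto_hyperfilter (hT : T.TN1) {C : ℝ≥0 → I} (hC : ∀ s, 0 < s → 0 < C s)
    {N : I → ℝ≥0 → ℕ} {X : ℕ → CompactNAFuzzySpace.{u} T} (hX : QuotientCondition N X)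
    (hdiam : ∀ s, 0 < s → ∀ n, C s ≤ diam (X n).met.M s) :
    ∃ p, Tendsto (fun n => mk (X n)) (hyperfilter ℕ) (𝓝 p) := by
  let m n := (X n).met
  let Y : CompactNAFuzzySpace.{u} T :=
    { carrier := Ultraproduct m
      nonempty := ⟨Quotient.mk _ fun n => (X n).nonempty.some⟩
      met := ultraproduct m
      compact := compactSpace_ultraproduct m fun t ε ht h0 h1 => by
        obtain ⟨a, ha, -⟩ := hX t ε ht h0 h1
        exact ⟨_, a, ha⟩ }
  refine ⟨mk Y, isPseudo_ghM.tendsto_nhds_iff.2 fun k => ?_⟩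
  have ht : 0 < seqT k := seqT_pos k
  set t₀ := seqT k / 2
  have ht₀ : 0 < t₀ := half_pos ht
  have hlt : t₀ < seqT k := NNReal.half_lt_self ht.ne'
  have hσ : σ (seqI k) < 1 := by
    rw [← unitInterval.symm_zero]; exact unitInterval.symm_lt_symm.2 (seqI_pos k)
  -- The first requirement on $\varepsilon$ makes the final bound $(1-\varepsilon) \ast
  -- (1-\varepsilon)$ good enough; the second, $C(t_0) \ast (1-\varepsilon) > 0$, keeps the
  -- denominators at $t_0$ from vanishing.
  obtain ⟨ε, h0, h1, hε, hCε⟩ := unitInterval.exists_pos_of_eventually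
    ((T.tendsto_symm_op_symm.eventually (lt_mem_nhds hσ)).and
      ((T.tendsto_op_symm (C t₀)).eventually (lt_mem_nhds (hC t₀ ht₀))))
  have hε1 : σ ε < 1 := by
    rw [← unitInterval.symm_zero]; exact unitInterval.symm_lt_symm.2 h0
  obtain ⟨a, hnet, hquot⟩ := hX t₀ ε ht₀ h0 h1
  have hCM n i j : C t₀ ≤ (m n).M (a n i) (a n j) t₀ :=
    (hdiam t₀ ht₀ n).trans
      (iInf₂_le (f := fun x y => (m n).M x y t₀) (a n i) (a n j))
  choose c hc using fun i j => hT.eventually_op_le hε1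
    ((hC t₀ ht₀).trans_le (ge_of_tendsto' (tendsto_ulim m (fun n => a n i) (fun n => a n j) t₀)
      fun n => hCM n i j)) (tendsto_ulim m (fun n => a n i) (fun n => a n j) t₀)
  have hS : ∀ᶠ n in hyperfilter ℕ, ∀ i j, T.op ((m n).M (a n i) (a n j) t₀) (σ ε) < c i j ∧
      c i j < (m n).M (a n i) (a n j) t₀ :=
    eventually_all.2 fun i => eventually_all.2 fun j => hc i j
  have key {n n' : ℕ}
      (hn : ∀ i j, T.op ((m n).M (a n i) (a n j) t₀) (σ ε) < c i j ∧
        c i j < (m n).M (a n i) (a n j) t₀)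
      (hn' : ∀ i j, T.op ((m n').M (a n' i) (a n' j) t₀) (σ ε) < c i j ∧
        c i j < (m n').M (a n' i) (a n' j) t₀) (i j) (s : ℝ≥0) (hs : t₀ < s) :
      T.op ((m n').M (a n' i) (a n' j) s) (σ ε) ≤ (m n).M (a n i) (a n j) s := by
    have hne : T.op ((m n').M (a n' i) (a n' j) t₀) (σ ε) ≠ 0 :=
      (hCε.trans_le (T.mono_left _ (hCM n' i j))).ne'
    exact op_le_of_quotient_le hne ((hn' i j).1.trans (hn i j).2).le
      fun h => hquot n n' s i j hs h hne
  filter_upwards [hS] with n hn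
  refine hε.trans_le ?_
  rw [isPseudo_ghM.symm _ _ _ ht]
  refine le_gh_ultraproduct m (a := a) ht₀ hlt (fun y => ?_) (fun y => exists_ulim_net m hnet y)
    (hS.mono fun k hk => key hn hk) (hS.mono fun k hk => key hk hn)
  obtain ⟨_, ⟨i, rfl⟩, hi⟩ := hnet n y
  exact ⟨i, hi.le⟩

end FuzzyGHSpace

/-! ### From convergent subsequences to compactness. -/

namespace FuzzySet

variable {T : ContTNorm} {α : Type*} {F : α → α → ℝ≥0 → I}

/-- A nonprincipal ultrafilter refines `atTop`, so its limit is a cluster point of the sequence, and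
neighbourhood filters are countably generated. -/
theorem IsPseudo.exists_tendsto_subseq (h : IsPseudo T F) {u : ℕ → α} {a : α}
    (hu : Tendsto u (hyperfilter ℕ) (@nhds α (FuzzySet.topology F h.mono) a)) :
    ∃ φ : ℕ → ℕ, StrictMono φ ∧ Tendsto (u ∘ φ) atTop (@nhds α (FuzzySet.topology F h.mono) a) := by
  let := h.uniformSpace
  have := h.isCountablyGenerated
  refine MapClusterPt.tendsto_subseq (x := a) ?_
  exact (ClusterPt.of_le_nhds hu).mono (map_mono Nat.hyperfilter_le_atTop)

/-- If every sequence in `S` has a convergent subsequence, then the closure of `S` is compact. -/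
theorem IsPseudo.isCompact_closure (h : IsPseudo T F) {S : Set α}
    (hS : ∀ u : ℕ → α, (∀ n, u n ∈ S) → ∃ (a : α) (φ : ℕ → ℕ), StrictMono φ ∧
      Tendsto (u ∘ φ) atTop (@nhds α (FuzzySet.topology F h.mono) a)) :
    @IsCompact α (FuzzySet.topology F h.mono) (@closure α (FuzzySet.topology F h.mono) S) := by
  let := h.uniformSpace
  have := h.isCountablyGenerated
  refine IsSeqCompact.isCompact fun u hu => ?_
  -- The sequence in the closure is shadowed by one in $S$ with errors tending to zero, so both
  -- converge along the same subsequence.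
  have happ n : ∃ v ∈ S, (u n, v) ∈ seqEntourage F n :=
    (UniformSpace.mem_closure_iff_ball.1 (hu n)
      ((hasBasis_uniformityFilter h.mono).mem_of_mem trivial)).imp fun v hv => ⟨hv.2, hv.1⟩
  choose v hvS huv using happ
  obtain ⟨a, φ, hφ, hlim⟩ := hS v hvS
  refine ⟨a, ?_, φ, hφ, ?_⟩
  · exact mem_closure_of_tendsto hlim (Eventually.of_forall fun n => hvS _)
  · rw [h.tendsto_nhds_iff] at hlim ⊢
    intro n
    obtain ⟨ε', h0, hε'⟩ := h.exists_comp_subset (seqI_pos n) (seqT_pos n)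
    obtain ⟨k, hk⟩ := exists_seqEntourage_subset h.mono h0 (seqT_pos n)
    filter_upwards [hlim k, eventually_ge_atTop k] with i hi hki
    refine hε' a (v (φ i)) _ (hk (show (a, v (φ i)) ∈ seqEntourage F k from hi)) ?_
    rw [h.symm _ _ _ (seqT_pos n)]
    exact hk (seqEntourage_anti h.mono (hki.trans (hφ.id_le i)) (huv (φ i)))

theorem IsPseudo.isCauchySeq_of_tendsto (h : IsPseudo T F) {u : ℕ → α} {a : α}
    (hu : Tendsto u atTop (@nhds α (FuzzySet.topology F h.mono) a)) : IsCauchySeq F u := by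
  intro t ε ht h0 _
  obtain ⟨ε', h0', hε'⟩ := h.exists_comp_subset h0 ht
  obtain ⟨k, hk⟩ := exists_seqEntourage_subset h.mono h0' ht
  obtain ⟨n₀, hn₀⟩ := eventually_atTop.1 (h.tendsto_nhds_iff.1 hu k)
  refine ⟨n₀, fun n n' hn hn' => hε' _ a _ ?_ ?_⟩
  · rw [h.symm _ _ _ ht]
    exact hk (show (a, u n) ∈ seqEntourage F k from hn₀ n hn)
  · exact hk (show (a, u n') ∈ seqEntourage F k from hn₀ n' hn')

theorem IsPseudo.tendsto_of_convergesTo (h : IsPseudo T F) {u : ℕ → α} {a : α}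
    (hu : ConvergesTo F u a) : Tendsto u atTop (@nhds α (FuzzySet.topology F h.mono) a) := by
  refine h.tendsto_nhds_iff.2 fun n => ?_
  have hσ : σ (seqI n) < 1 := by
    rw [← unitInterval.symm_zero]; exact unitInterval.symm_lt_symm.2 (seqI_pos n)
  filter_upwards [(hu _ (seqT_pos n)).eventually (lt_mem_nhds hσ)] with k hk
  rwa [h.symm _ _ _ (seqT_pos n)]

theorem IsPseudo.isCompact_of_completeOn (h : IsPseudo T F) {S : Set α}
    (hS : ∀ u : ℕ → α, (∀ n, u n ∈ S) → ∃ (a : α) (φ : ℕ → ℕ), StrictMono φ ∧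
      Tendsto (u ∘ φ) atTop (@nhds α (FuzzySet.topology F h.mono) a))
    (hc : CompleteOn F S) : @IsCompact α (FuzzySet.topology F h.mono) S := by
  let := h.uniformSpace
  have := h.isCountablyGenerated
  refine IsSeqCompact.isCompact fun u hu => ?_
  obtain ⟨a, φ, hφ, hlim⟩ := hS u hu
  -- The limit $a$ may lie outside $S$; it only serves to show that the subsequence is Cauchy.
  obtain ⟨b, hb, hconv⟩ := hc (u ∘ φ) (fun n => hu _) (h.isCauchySeq_of_tendsto hlim)
  exact ⟨b, hb, φ, hφ, h.tendsto_of_convergesTo hconv⟩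

end FuzzySet

end

theorem theorem4 (T : ContTNorm) (hT : T.TN1) (𝓜 : Set (CompactNAFuzzySpace.{u} T))
    (C : ℝ≥0 → I)
    (hC_mono : MonotoneOn C (Set.Ioi 0))
    (hC_left : ∀ s, 0 < s → ContinuousWithinAt C (Set.Iic s) s)
    (hC_pos : ∀ s, 0 < s → 0 < C s)
    (hC_diam : ∀ s, 0 < s → ∀ X ∈ 𝓜, C s ≤ FuzzySet.diam X.met.M s)
    (N : I → ℝ≥0 → ℕ)
    (hN : ∀ (t : ℝ≥0) (ε : I), 0 < t → 0 < ε → ε < 1 →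
      ∀ X ∈ 𝓜, FuzzySet.cov X.met.M ε t ≤ (N ε t : ℕ∞))
    (hQ : ∀ X : ℕ → CompactNAFuzzySpace.{u} T, (∀ n, X n ∈ 𝓜) → QuotientCondition N X) :
    IsCompact (closure (FuzzyGHSpace.classes 𝓜)) ∧
      (FuzzySet.CompleteOn FuzzyGHSpace.ghM (FuzzyGHSpace.classes 𝓜) →
        IsCompact (FuzzyGHSpace.classes 𝓜)) := by
  have hsub : ∀ u : ℕ → FuzzyGHSpace.{u} T, (∀ n, u n ∈ FuzzyGHSpace.classes 𝓜) →
      ∃ (p : FuzzyGHSpace.{u} T) (φ : ℕ → ℕ), StrictMono φ ∧ Tendsto (u ∘ φ) atTop (𝓝 p) := by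
    intro u hu
    choose X hX hXu using hu
    obtain rfl : (fun n => FuzzyGHSpace.mk (X n)) = u := funext hXu
    obtain ⟨p, hp⟩ := FuzzyGHSpace.exists_tendsto_hyperfilter hT hC_pos (hQ X hX)
      fun s hs n => hC_diam s hs (X n) (hX n)
    obtain ⟨φ, hφ, hlim⟩ := FuzzyGHSpace.isPseudo_ghM.exists_tendsto_subseq hp
    exact ⟨p, φ, hφ, hlim⟩
  exact ⟨FuzzyGHSpace.isPseudo_ghM.isCompact_closure hsub,
    FuzzyGHSpace.isPseudo_ghM.isCompact_of_completeOn hsub⟩
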